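/- Consider eight parties $v_1,\dots,v_8$ whose local quantum systems have the dimensions $\boldsymbol d_0=(4,4,4,4,4,4,4,2)$: each of $v_1,\dots,v_7$ holds a target qubit $\mathcal H^{v_k}$ and an auxiliary qubit $\mathcal H_{\mathrm a}^{v_k}$, and $v_8$ holds one target qubit $\mathcal H^{v_8}$. States of the eight target qubits are regarded as states of the total system by putting all auxiliary qubits in $|0\rangle$. Let $p(1)=2$, $p(2)=p(3)=4$, $p(5)=6$, $p(4)=p(6)=p(7)=8$. For $\boldsymbol\alpha=(\alpha_1,\dots,\alpha_7)$ with $0\le\alpha_i<2\pi$ let $|\psi(\boldsymbol\alpha)\rangle=\prod_{i=1}^{7}\exp\bigl(\mathrm i\alpha_i Z^{v_i}\otimes Z^{v_{p(i)}}\bigr)\,|+\rangle^{\otimes 8}$ (a circuit with gates on $v_1v_2,\,v_3v_4,\,v_5v_6,\,v_7v_8$, then $v_2v_4,\,v_6v_8$, then $v_4v_8$), and let $S_0$ be the set of all these states. Let $|\Phi_{\mathrm{res}}\rangle$ be the 15-qubit graph state of the tree in which, for $i=1,\dots,7$, the auxiliary qubit of $v_i$ is joined to the target qubits of $v_i$ and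 of $v_{p(i)}$. LOCC within $\boldsymbol d_0$ means finitely many rounds in which one party performs a measurement on its own system (any Kraus operators $M_j$ on that system with $\sum_j M_j^\dagger M_j=1$, no added auxiliary system) and announces the outcome, on which all later steps may depend. A round of quantum communication moves the state of a subsystem of one party into a subsystem of the same dimension of another party that is in the state $|0\rangle$, and leaves the sender's subsystem in $|0\rangle$. A resource state $|\phi\rangle$ of the total system achieves the preparation of $S_0$ in the static setting if for every $|\psi\rangle\in S_0$ some LOCC protocol within $\boldsymbol d_0$ transforms $|\phi\rangle$ into $|\psi\rangle$ deterministically and exactly; it does so in the dynamic setting if, in addition, $|\phi\rangle$ itself can be prepared deterministically from $|0\cdots0\rangle$ by LOCC within $\boldsymbol d_0$ and finitely many rounds of quantum communication. A state consists of bipartite entanglement if, up to local unitaries (isometries into the local systems), it is a tensor product $\bigotimes_{e\in E}|\phi_e\rangle^e$ of bipartite entangled states shared along the edges of a graph on the parties. Then $|\Phi_{\mathrm{res}}\rangle$ is a fully entangled state (entangled across every bipartition of the parties) that achieves the preparation of $S_0$ in the dynamic setting within $\boldsymbol d_0$; moreover it can be prepared from $|0\cdots0\rangle$ by a fixed sequence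 of initializations of single qubits as $|+\rangle$, $CZ$ gates on the two qubits of one party, and communications of single qubits. In contrast, no state consisting of bipartite entanglement achieves the preparation of $S_0$ in the static setting within $\boldsymbol d_0$. -/

import Mathlib

noncomputable section

namespace SizeLimited

/-! ### Multipartite systems of limited size -/

/-- Labels of the product basis of the total system of the parties `v_1, …, v_N`, where party `k`
holds a quantum system of dimension `d k`. -/
abbrev Config {N : ℕ} (d : Fin N → ℕ) : Type := (k : Fin N) → Fin (d k)

/-- Vectors of `⨂ₖ ℂ^(d k)`, given by their amplitudes in the product basis. -/
abbrev Ket {N : ℕ} (d : Fin N → ℕ) : Type := Config d → ℂ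

/-- Unit vectors, that is, pure states. -/
def IsState {N : ℕ} {d : Fin N → ℕ} (φ : Ket d) : Prop := ∑ x, ‖φ x‖ ^ 2 = 1

/-- The product state `|0⟩ ⊗ ⋯ ⊗ |0⟩`. -/
def zeroKet {N : ℕ} (d : Fin N → ℕ) : Ket d := fun x => if ∀ k, (x k).val = 0 then 1 else 0

/-- `φ` is a product vector with respect to the bipartition of the parties into `A` and its
complement. -/
def IsProductAcross {N : ℕ} {d : Fin N → ℕ} (A : Set (Fin N)) (φ : Ket d) : Prop :=
  ∃ (f : ((k : {k // k ∈ A}) → Fin (d k)) → ℂ) (g : ((k : {k // k ∉ A}) → Fin (d k)) → ℂ),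
    ∀ x, φ x = f (fun k => x k) * g (fun k => x k)

/-- Entangled with respect to every bipartition of the parties. -/
def FullyEntangled {N : ℕ} {d : Fin N → ℕ} (φ : Ket d) : Prop :=
  ∀ A : Set (Fin N), A.Nonempty → Aᶜ.Nonempty → ¬ IsProductAcross A φ

/-- The inclusion of `⨂ₖ ℂ^(t k)` into `⨂ₖ ℂ^(d k)`, where `ℂ^(t k)` is the subspace of `ℂ^(d k)`
spanned by the first `t k` basis vectors. -/
def embed {N : ℕ} {t : Fin N → ℕ} (d : Fin N → ℕ) (ψ : Ket t) : Ket d := fun x =>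
  if h : ∀ k, (x k).val < t k then ψ (fun k => ⟨x k, h k⟩) else 0

/-! ### Protocols: local measurements, classical communication, quantum communication -/

/-- The action of the operator `M` on the system of party `k`. -/
def applyLocal {N : ℕ} {d : Fin N → ℕ} (k : Fin N) (M : Matrix (Fin (d k)) (Fin (d k)) ℂ)
    (φ : Ket d) : Ket d :=
  fun x => ∑ j, M (x k) j * φ (Function.update x k j)

/-- One round of quantum communication of a `dim`-dimensional system: the systems of the sender
and of the receiver are each factorized into a `dim`-dimensional subsystem and a rest. -/
structure Communication {N : ℕ} (d : Fin N → ℕ) where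
  sender : Fin N
  receiver : Fin N
  ne : sender ≠ receiver
  dim : ℕ
  restS : ℕ
  restR : ℕ
  splitS : Fin (d sender) ≃ Fin dim × Fin restS
  splitR : Fin (d receiver) ≃ Fin dim × Fin restR

/-- The receiver's subsystem is in the state `|0⟩`. -/
def Communication.Ready {N : ℕ} {d : Fin N → ℕ} (c : Communication d) (φ : Ket d) : Prop :=
  ∀ x : Config d, (c.splitR (x c.receiver)).1.val ≠ 0 → φ x = 0

/-- Exchange of the labels of the two subsystems. -/
def Communication.exchange {N : ℕ} {d : Fin N → ℕ} (c : Communication d) (x : Config d) :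
    Config d :=
  Function.update
    (Function.update x c.sender
      (c.splitS.symm ((c.splitR (x c.receiver)).1, (c.splitS (x c.sender)).2)))
    c.receiver
    (c.splitR.symm ((c.splitS (x c.sender)).1, (c.splitR (x c.receiver)).2))

/-- The effect of the communication. It is only ever used on vectors with `c.Ready φ`: then the
receiver's subsystem takes over the state of the sender's subsystem, which is left in `|0⟩`. -/
def Communication.transmit {N : ℕ} {d : Fin N → ℕ} (c : Communication d) (φ : Ket d) : Ket d :=
  fun x => φ (c.exchange x)

/-- Finite protocols. In `measure k n M next`, party `k` performs on its system the measurement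
with Kraus operators `M 0, …, M (n-1)`, announces the outcome `j` to all parties, and the protocol
goes on with `next j`; a local unitary is the case `n = 1`. No auxiliary system is ever added. -/
inductive Protocol {N : ℕ} (d : Fin N → ℕ) : Type
  | halt : Protocol d
  | measure (k : Fin N) (n : ℕ) (M : Fin n → Matrix (Fin (d k)) (Fin (d k)) ℂ)
      (next : Fin n → Protocol d) : Protocol d
  | send (c : Communication d) (next : Protocol d) : Protocol d

/-- All local measurements of the protocol are complete: `∑ⱼ Mⱼ† Mⱼ = 1`. -/
def Protocol.IsValid {N : ℕ} {d : Fin N → ℕ} : Protocol d → Prop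
  | .halt => True
  | .measure _ _ M next => ∑ j, (M j).conjTranspose * M j = 1 ∧ ∀ j, (next j).IsValid
  | .send _ next => next.IsValid

/-- The protocol uses no quantum communication. -/
def Protocol.NoQuantumCommunication {N : ℕ} {d : Fin N → ℕ} : Protocol d → Prop
  | .halt => True
  | .measure _ _ _ next => ∀ j, (next j).NoQuantumCommunication
  | .send _ _ => False

/-- LOCC within the configuration `d`. -/
def Protocol.IsLOCC {N : ℕ} {d : Fin N → ℕ} (P : Protocol d) : Prop :=
  P.IsValid ∧ P.NoQuantumCommunication

/-- `P.Transforms φ ψ`: started in `φ`, the protocol ends in the state `ψ` in every branch of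
measurement outcomes. Vectors are not renormalized after a measurement, so that a final vector is a
multiple of `ψ`, and it is `0` exactly for a branch of probability `0`. -/
def Protocol.Transforms {N : ℕ} {d : Fin N → ℕ} : Protocol d → Ket d → Ket d → Prop
  | .halt, φ, ψ => ∃ c : ℂ, φ = c • ψ
  | .measure k _ M next, φ, ψ => ∀ j, (next j).Transforms (applyLocal k (M j) φ) ψ
  | .send c next, φ, ψ => c.Ready φ ∧ next.Transforms (c.transmit φ) ψ

/-- The resource state `φ` achieves the preparation of the target set `S` in the static setting:
`φ` can be transformed deterministically and exactly into every `ψ ∈ S` by LOCC within the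
configuration `d`. -/
def AchievesStatic {N : ℕ} {t d : Fin N → ℕ} (φ : Ket d) (S : Set (Ket t)) : Prop :=
  ∀ ψ ∈ S, ∃ P : Protocol d, P.IsLOCC ∧ P.Transforms φ (embed d ψ)

/-- The resource state `φ` achieves the preparation of `S` in the dynamic setting: the parties can
prepare `φ` from scratch by LOCC within `d` and quantum communication, and `φ` can then be
transformed into every `ψ ∈ S` by LOCC within `d`. -/
def AchievesDynamic {N : ℕ} {t d : Fin N → ℕ} (φ : Ket d) (S : Set (Ket t)) : Prop :=
  (∃ P : Protocol d, P.IsValid ∧ P.Transforms (zeroKet d) φ) ∧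
    AchievesStatic φ S

/-! ### States consisting of bipartite entanglement -/

/-- `φ` is equivalent, under local isometries `V k` into the systems of the parties, to a tensor
product `⨂ₑ |φₑ⟩` of bipartite entangled states along the edges of a graph on the parties.
For adjacent `k`, `l`, party `k` holds a system of dimension `m k l` of the state `χ k l` (`k < l`)
that it shares with `l`; for non-adjacent `k`, `l` the dimension `m k l` is `1`. -/
def ConsistsOfBipartite {N : ℕ} {d : Fin N → ℕ} (φ : Ket d) : Prop :=
  ∃ (G : SimpleGraph (Fin N)) (_ : DecidableRel G.Adj) (m : Fin N → Fin N → ℕ)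
    (χ : (k l : Fin N) → Fin (m k l) → Fin (m l k) → ℂ)
    (V : (k : Fin N) → Matrix (Fin (d k)) ((l : Fin N) → Fin (m k l)) ℂ),
    (∀ k l, ¬ G.Adj k l → m k l = 1) ∧
    (∀ k l, k < l → G.Adj k l →
      ∑ i, ∑ j, ‖χ k l i j‖ ^ 2 = 1 ∧
        ¬ ∃ (a : Fin (m k l) → ℂ) (b : Fin (m l k) → ℂ), ∀ i j, χ k l i j = a i * b j) ∧
    (∀ k, (V k).conjTranspose * V k = 1) ∧
    ∀ x, φ x = ∑ s : (k : Fin N) → (l : Fin N) → Fin (m k l),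
      (∏ k, V k (x k) (s k)) *
        ∏ e : Fin N × Fin N with e.1 < e.2 ∧ G.Adj e.1 e.2, χ e.1 e.2 (s e.1 e.2) (s e.2 e.1)

/-! ### Qubits, graph states and the circuit of the target set -/

/-- `|+⟩ ⊗ ⋯ ⊗ |+⟩` on qubits labelled by `V`. -/
def plusKet (V : Type) [Fintype V] : (V → Fin 2) → ℂ := fun _ => (1 / (√2 : ℂ)) ^ Fintype.card V

/-- The controlled-`Z` gate on the qubits `u` and `v`. -/
def cz {V : Type} (u v : V) (ψ : (V → Fin 2) → ℂ) : (V → Fin 2) → ℂ :=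
  fun b => if b u = 1 ∧ b v = 1 then -ψ b else ψ b

/-- The graph state of the graph with the listed edges. -/
def graphKet {V : Type} [Fintype V] (edges : List (V × V)) : (V → Fin 2) → ℂ :=
  edges.foldr (fun e ψ => cz e.1 e.2 ψ) (plusKet V)

/-- The eigenvalues `1`, `-1` of the Pauli operator `Z` on `|0⟩`, `|1⟩`. -/
def zSign (b : Fin 2) : ℝ := if b = 0 then 1 else -1

/-- The gate `exp(iα Z ⊗ Z)` on the qubits `u` and `v`. -/
def zzGate {V : Type} (α : ℝ) (u v : V) (ψ : (V → Fin 2) → ℂ) : (V → Fin 2) → ℂ :=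
  fun b => Complex.exp (Complex.I * (α * zSign (b u) * zSign (b v))) * ψ b

/-- The configuration of system sizes: two qubits at each of `v_1, …, v_7`, one qubit at `v_8`
(the party `v_k` has the index `k - 1`). -/
def d₀ : Fin 8 → ℕ := ![4, 4, 4, 4, 4, 4, 4, 2]

/-- The dimensions of the parts of the systems that hold the target states: one qubit each. -/
def t₀ : Fin 8 → ℕ := fun _ => 2

/-- The seven gates of the circuit act on the pairs `{v_i, parent i}`, `i = 1, …, 7`:
`{v_1, v_2}, {v_3, v_4}, {v_5, v_6}, {v_7, v_8}`, then `{v_2, v_4}, {v_6, v_8}`, then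
`{v_4, v_8}`. -/
def parent : Fin 7 → Fin 8 := ![1, 3, 3, 7, 5, 7, 7]

/-- The output `|ψ(α)⟩` of the circuit on the input `|+⟩^{⊗ 8}`. -/
def targetKet (α : Fin 7 → ℝ) : Ket t₀ :=
  (List.finRange 7).foldr (fun i ψ => zzGate (V := Fin 8) (α i) i.castSucc (parent i) ψ)
    (plusKet (Fin 8))

/-- The target set. -/
def S₀ : Set (Ket t₀) :=
  {ψ | ∃ α : Fin 7 → ℝ, (∀ i, 0 ≤ α i ∧ α i < 2 * Real.pi) ∧ ψ = targetKet α}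

/-- The values of the `15` qubits in a product basis vector: `Sum.inl k` is the target qubit of
party `k`, `Sum.inr k` is the auxiliary qubit of party `k`; a local basis label is
`target + 2 * auxiliary`. -/
def qubitValues (x : Config d₀) : Fin 8 ⊕ Fin 7 → Fin 2
  | .inl k => Fin.ofNat 2 (x k).val
  | .inr k => Fin.ofNat 2 ((x k.castSucc).val / 2)

/-- The edges of the tree on the `15` qubits: the auxiliary qubit of `v_i` is joined to the target
qubits of the two parties on which the `i`-th gate acts. -/
def resEdges : List ((Fin 8 ⊕ Fin 7) × (Fin 8 ⊕ Fin 7)) :=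
  (List.finRange 7).flatMap fun i =>
    [(Sum.inr i, Sum.inl i.castSucc), (Sum.inr i, Sum.inl (parent i))]

/-- The graph state `|Φ_res⟩` of `15` qubits, as a state of the eight parties. -/
def Φres : Ket d₀ := fun x => graphKet resEdges (qubitValues x)

/-! ### Elementary preparation protocols -/

/-- The two qubits of a party. -/
inductive Slot
  | target
  | auxiliary

def Slot.other : Slot → Slot
  | .target => .auxiliary
  | .auxiliary => .target

/-- The value of a qubit in the local basis vector with label `x = target + 2 * auxiliary`. -/
def Slot.bit : Slot → ℕ → ℕ
  | .target, x => x % 2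
  | .auxiliary, x => x / 2

/-- Initialization of a qubit of party `k` as `|+⟩`: Kraus operators `|+⟩⟨0|` and `|+⟩⟨1|`. -/
def initPlus (k : Fin 8) (s : Slot) (j : Fin 2) : Matrix (Fin (d₀ k)) (Fin (d₀ k)) ℂ :=
  Matrix.of fun y x => if s.bit x = j ∧ s.other.bit y = s.other.bit x then 1 / (√2 : ℂ) else 0

/-- The controlled-`Z` gate on the two qubits of party `k`. -/
def localCZ (k : Fin 8) : Matrix (Fin (d₀ k)) (Fin (d₀ k)) ℂ :=
  Matrix.diagonal fun x =>
    if Slot.target.bit x = 1 ∧ Slot.auxiliary.bit x = 1 then -1 else 1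

/-- The communication moves one qubit of the sender to one qubit of the receiver. -/
def Communication.IsSingleQubit (c : Communication d₀) : Prop :=
  c.dim = 2 ∧
    (∃ s : Slot, ∀ x, (c.splitS x).1.val = s.bit x ∧ (c.splitS x).2.val = s.other.bit x) ∧
    ∃ s : Slot, ∀ x, (c.splitR x).1.val = s.bit x ∧ (c.splitR x).2.val = s.other.bit x

/-- Protocols that are a fixed sequence of initializations of single qubits as `|+⟩`, `CZ` gates on
the two qubits of one party, and communications of single qubits. -/
inductive IsCZSequence : Protocol d₀ → Prop
  | halt : IsCZSequence .halt
  | initPlus (k : Fin 8) (s : Slot) (P : Protocol d₀) :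
      IsCZSequence P → IsCZSequence (.measure k 2 (initPlus k s) fun _ => P)
  | localCZ (k : Fin 8) (P : Protocol d₀) :
      IsCZSequence P → IsCZSequence (.measure k 1 (fun _ => localCZ k) fun _ => P)
  | send (c : Communication d₀) (P : Protocol d₀) :
      c.IsSingleQubit → IsCZSequence P → IsCZSequence (.send c P)

end SizeLimited

end

/-!
LOCC cannot raise the Schmidt rank across a cut, and the circuit with `n` disjoint gates across a
cut at the angle `π/4`, and all other angles `0`, prepares a state of Schmidt rank `2 ^ n`. A
product of bipartite states has Schmidt rank across a cut at most the product of the dimensions of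
the subsystems shared across it. For `{v_8}` this capacity is at most `2`. If it is at most `2` for
a set of parties, it stays so when a suitable party is added: that party shares a subsystem of
dimension at least `2` with the set, so the size limit `4` leaves it only dimension `2` for
sharing with the rest. But after at most two such additions to `{v_8}` two disjoint gates cross the
cut, which requires Schmidt rank `4`.

The resource state is prepared by moving target qubits from party to party, and the measurement of
the auxiliary qubit of `v_i`, corrected by `Z` on its two neighbours, turns its two edges into the
`i`-th gate.
-/

noncomputable section

namespace SizeLimited

/-! ### Schmidt ranks -/

section SchmidtRank

variable {ι : Type*} {S T : ι → Type*}

open Classical in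
/-- The amplitudes of `φ` arranged as a matrix: the rows are the configurations of the parties
in `A`, the columns those of the other parties. -/
def cutMatrix (A : Set ι) (φ : (∀ k, S k) → ℂ) :
    Matrix (∀ k : {k // k ∈ A}, S k) (∀ k : {k // k ∉ A}, S k) ℂ :=
  Matrix.of fun a b => φ fun k => if h : k ∈ A then a ⟨k, h⟩ else b ⟨k, h⟩

variable [Fintype ι] [DecidableEq ι] [∀ k, Fintype (S k)]

open Classical in
/-- The Schmidt rank of `φ` across the bipartition of the parties into `A` and its complement. -/
def schmidtRank (A : Set ι) (φ : (∀ k, S k) → ℂ) : ℕ :=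
  (cutMatrix A φ).rank

theorem schmidtRank_le_card {κ : Type*} [Fintype κ] {A : Set ι} {φ : (∀ k, S k) → ℂ}
    (r : (∀ k : {k // k ∈ A}, S k) → κ) (F : (∀ k : {k // k ∈ A}, S k) → ℂ)
    (G : κ → (∀ k : {k // k ∉ A}, S k) → ℂ)
    (hφ : ∀ x, φ x = F (fun k => x k) * G (r fun k => x k) (fun k => x k)) :
    schmidtRank A φ ≤ Fintype.card κ := by
  classical
  have hfactor : cutMatrix A φ =
      (Matrix.of fun a c => if c = r a then F a else 0) * Matrix.of G := by
    ext a b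
    have ha : (fun k : {k // k ∈ A} => if h : k.1 ∈ A then a ⟨k, h⟩ else b ⟨k, h⟩) = a :=
      funext fun k => dif_pos k.2
    have hb : (fun k : {k // k ∉ A} => if h : k.1 ∈ A then a ⟨k, h⟩ else b ⟨k, h⟩) = b :=
      funext fun k => dif_neg k.2
    simp only [cutMatrix, Matrix.of_apply, Matrix.mul_apply, hφ, ha, hb, ite_mul, zero_mul,
      Finset.sum_ite_eq', Finset.mem_univ, if_true]
  rw [schmidtRank, hfactor]
  exact (Matrix.rank_mul_le_left _ _).trans (Matrix.rank_le_card_width _)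

open Classical in
theorem card_le_schmidtRank {κ : Type*} [Fintype κ] [DecidableEq κ] {A : Set ι}
    {φ : (∀ k, S k) → ℂ} (a b : κ → ∀ k, S k)
    (hdet : (Matrix.of fun i j => φ (A.piecewise (a i) (b j))).det ≠ 0) :
    Fintype.card κ ≤ schmidtRank A φ := by
  have hsub : (Matrix.of fun i j => φ (A.piecewise (a i) (b j))) =
      (cutMatrix A φ).submatrix (fun i k => a i k) (fun j k => b j k) := by
    ext i j
    simp only [cutMatrix, Matrix.submatrix_apply, Matrix.of_apply, dite_eq_ite]
    rfl
  rw [← Matrix.rank_of_isUnit _ ((Matrix.isUnit_iff_isUnit_det _).2 hdet.isUnit), hsub]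
  exact Matrix.rank_submatrix_le _ _ _

theorem schmidtRank_comp_le [∀ k, Fintype (T k)] (A : Set ι) (e : ∀ k, T k → S k)
    (φ : (∀ k, S k) → ℂ) : schmidtRank A (fun x => φ fun k => e k (x k)) ≤ schmidtRank A φ := by
  classical
  have hsub : cutMatrix A (fun x => φ fun k => e k (x k)) =
      (cutMatrix A φ).submatrix (fun a k => e k (a k)) (fun b k => e k (b k)) := by
    ext a b
    simp [cutMatrix, apply_dite (e _)]
  rw [schmidtRank, hsub]
  exact Matrix.rank_submatrix_le _ _ _

theorem schmidtRank_smul (A : Set ι) {c : ℂ} (hc : c ≠ 0) (φ : (∀ k, S k) → ℂ) :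
    schmidtRank A (c • φ) = schmidtRank A φ := by
  classical
  exact Matrix.rank_smul_of_mem_nonZeroDivisors (cutMatrix A φ) (mem_nonZeroDivisors_of_ne_zero hc)

theorem schmidtRank_tensor_le [∀ k, Fintype (T k)] (A : Set ι)
    (V : ∀ k, Matrix (T k) (S k) ℂ) (φ : (∀ k, S k) → ℂ) :
    schmidtRank A (fun x => ∑ s, (∏ k, V k (x k) (s k)) * φ s) ≤ schmidtRank A φ := by
  classical
  let VA : Matrix (∀ k : {k // k ∈ A}, T k) (∀ k : {k // k ∈ A}, S k) ℂ :=
    Matrix.of fun a s => ∏ k : {k // k ∈ A}, V k (a k) (s k)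
  let VB : Matrix (∀ k : {k // k ∉ A}, S k) (∀ k : {k // k ∉ A}, T k) ℂ :=
    Matrix.of fun s b => ∏ k : {k // k ∉ A}, V k (b k) (s k)
  have hfactor : cutMatrix A (fun x => ∑ s, (∏ k, V k (x k) (s k)) * φ s) =
      VA * cutMatrix A φ * VB := by
    ext a b
    simp only [VA, VB, cutMatrix, Matrix.of_apply, Matrix.mul_apply, Finset.sum_mul]
    rw [← (Equiv.piEquivPiSubtypeProd (· ∈ A) S).symm.sum_comp, Fintype.sum_prod_type_right]
    refine Finset.sum_congr rfl fun t _ => Finset.sum_congr rfl fun s _ => ?_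
    rw [← Fintype.prod_subtype_mul_prod_subtype (· ∈ A), mul_right_comm]
    refine congrArg₂ _ (congrArg₂ _ (Fintype.prod_congr _ _ fun k => ?_) rfl)
      (Fintype.prod_congr _ _ fun k => ?_) <;> simp [k.2]
  rw [schmidtRank, hfactor]
  exact (Matrix.rank_mul_le_left _ _).trans (Matrix.rank_mul_le_right _ _)

end SchmidtRank

theorem IsProductAcross.schmidtRank_le_one {N : ℕ} {d : Fin N → ℕ} {A : Set (Fin N)} {φ : Ket d}
    (h : IsProductAcross A φ) : schmidtRank A φ ≤ 1 := by
  obtain ⟨f, g, hφ⟩ := h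
  exact schmidtRank_le_card (κ := Unit) (fun _ => ()) f (fun _ => g) hφ

theorem schmidtRank_le_schmidtRank_embed {N : ℕ} {t d : Fin N → ℕ} (htd : ∀ k, t k ≤ d k)
    (A : Set (Fin N)) (ψ : Ket t) : schmidtRank A ψ ≤ schmidtRank A (embed d ψ) := by
  have hψ : ψ = fun x => embed d ψ fun k => Fin.castLE (htd k) (x k) := by
    ext x
    simp [embed]
  exact (congrArg (schmidtRank A) hψ).trans_le (schmidtRank_comp_le A _ _)

/-! ### Schmidt ranks under LOCC -/

section LOCC

variable {N : ℕ} {d : Fin N → ℕ}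

theorem applyLocal_eq_tensor (k : Fin N) (M : Matrix (Fin (d k)) (Fin (d k)) ℂ) (φ : Ket d) :
    applyLocal k M φ = fun x =>
      ∑ s, (∏ l, Function.update (1 : ∀ l, Matrix (Fin (d l)) (Fin (d l)) ℂ) k M l (x l) (s l)) *
        φ s := by
  ext x
  refine Fintype.sum_of_injective (Function.update x k) (Function.update_injective x k) _ _
    (fun s hs => ?_) fun j => ?_
  · obtain ⟨l, hlk, hl⟩ : ∃ l, l ≠ k ∧ x l ≠ s l := by
      by_contra! h
      exact hs ⟨s k, Function.update_eq_iff.2 ⟨rfl, h⟩⟩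
    rw [Finset.prod_eq_zero (Finset.mem_univ l), zero_mul]
    simp [hlk, hl]
  · rw [Finset.prod_eq_single k (fun l _ hl => by simp [hl]) (by simp)]
    simp

theorem schmidtRank_applyLocal_le (A : Set (Fin N)) (k : Fin N)
    (M : Matrix (Fin (d k)) (Fin (d k)) ℂ) (φ : Ket d) :
    schmidtRank A (applyLocal k M φ) ≤ schmidtRank A φ :=
  (congrArg (schmidtRank A) (applyLocal_eq_tensor k M φ)).trans_le (schmidtRank_tensor_le A _ φ)

theorem applyLocal_applyLocal (k : Fin N) (M M' : Matrix (Fin (d k)) (Fin (d k)) ℂ) (φ : Ket d) :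
    applyLocal k M (applyLocal k M' φ) = applyLocal k (M * M') φ := by
  ext x
  simp only [applyLocal, Matrix.mul_apply, Function.update_self, Function.update_idem,
    Finset.mul_sum, Finset.sum_mul]
  rw [Finset.sum_comm]
  simp only [mul_assoc]

theorem applyLocal_diagonal (k : Fin N) (D : Fin (d k) → ℂ) (φ : Ket d) (x : Config d) :
    applyLocal k (Matrix.diagonal D) φ x = D (x k) * φ x := by
  simp [applyLocal, Matrix.diagonal_apply]

theorem applyLocal_one (k : Fin N) (φ : Ket d) : applyLocal k 1 φ = φ := by
  ext x
  rw [← Matrix.diagonal_one, applyLocal_diagonal, one_mul]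

theorem applyLocal_smul (k : Fin N) (M : Matrix (Fin (d k)) (Fin (d k)) ℂ) (c : ℂ) (φ : Ket d) :
    applyLocal k M (c • φ) = c • applyLocal k M φ := by
  ext x
  simp [applyLocal, Finset.mul_sum, mul_left_comm]

theorem applyLocal_sum {n : ℕ} (k : Fin N) (M : Fin n → Matrix (Fin (d k)) (Fin (d k)) ℂ)
    (φ : Ket d) : applyLocal k (∑ j, M j) φ = ∑ j, applyLocal k (M j) φ := by
  ext x
  simp only [applyLocal, Matrix.sum_apply, Finset.sum_apply, Finset.sum_mul]
  exact Finset.sum_comm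

theorem exists_applyLocal_ne_zero {k : Fin N} {n : ℕ} {M : Fin n → Matrix (Fin (d k)) (Fin (d k)) ℂ}
    (hM : ∑ j, (M j).conjTranspose * M j = 1) {φ : Ket d} (hφ : φ ≠ 0) :
    ∃ j, applyLocal k (M j) φ ≠ 0 := by
  by_contra! h
  refine hφ ?_
  calc φ = ∑ j, applyLocal k (M j).conjTranspose (applyLocal k (M j) φ) := by
        simp only [applyLocal_applyLocal, ← applyLocal_sum, hM, applyLocal_one]
    _ = 0 := Finset.sum_eq_zero fun j _ => by rw [h j]; ext x; simp [applyLocal]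

theorem schmidtRank_le_of_transforms (A : Set (Fin N)) {P : Protocol d} (hP : P.IsLOCC)
    {φ ψ : Ket d} (hφ : φ ≠ 0) (h : P.Transforms φ ψ) : schmidtRank A ψ ≤ schmidtRank A φ := by
  induction P generalizing φ with
  | halt =>
    obtain ⟨c, rfl⟩ := h
    have hc : c ≠ 0 := by rintro rfl; simp at hφ
    exact (schmidtRank_smul A hc ψ).ge
  | measure k n M next ih =>
    obtain ⟨j, hj⟩ := exists_applyLocal_ne_zero hP.1.1 hφ
    exact (ih j ⟨hP.1.2 j, hP.2 j⟩ hj (h j)).trans (schmidtRank_applyLocal_le A k (M j) φ)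
  | send c next _ => exact hP.2.elim

theorem Protocol.Transforms.smul_left {P : Protocol d} {φ ψ : Ket d} (h : P.Transforms φ ψ)
    (c : ℂ) : P.Transforms (c • φ) ψ := by
  induction P generalizing φ with
  | halt =>
    obtain ⟨a, rfl⟩ := h
    exact ⟨c * a, smul_smul c a ψ⟩
  | measure k n M next ih => exact fun j => applyLocal_smul k (M j) c φ ▸ ih j (h j)
  | send e next ih => exact ⟨fun x hx => by simp [h.1 x hx], ih h.2⟩

theorem Protocol.Transforms.smul_right {P : Protocol d} {φ ψ : Ket d} (h : P.Transforms φ ψ)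
    {c : ℂ} (hc : c ≠ 0) : P.Transforms φ (c • ψ) := by
  induction P generalizing φ with
  | halt =>
    obtain ⟨a, rfl⟩ := h
    exact ⟨a * c⁻¹, by rw [smul_smul, inv_mul_cancel_right₀ hc]⟩
  | measure k n M next ih => exact fun j => ih j (h j)
  | send e next ih => exact ⟨h.1, ih h.2⟩

end LOCC

/-! ### States consisting of bipartite entanglement -/

section Bipartite

variable {ι : Type*} [Fintype ι] [DecidableEq ι]

/-- The bound on the Schmidt rank across `A` of a product of bipartite states: the product over all
pairs of a party in `A` and one outside `A` of the dimension `m k l` of the subsystem of `k` that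
is shared with `l`. -/
def cutCapacity (m : ι → ι → ℕ) (A : Finset ι) : ℕ :=
  ∏ k ∈ A, ∏ l ∈ Aᶜ, m k l

theorem schmidtRank_prod_edges_le (A : Finset ι) (m : ι → ι → ℕ)
    (χ : ∀ k l, Fin (m k l) → Fin (m l k) → ℂ) (E : Finset (ι × ι)) :
    schmidtRank (S := fun k => ∀ l, Fin (m k l)) A
      (fun s => ∏ e ∈ E, χ e.1 e.2 (s e.1 e.2) (s e.2 e.1)) ≤ cutCapacity m A := by
  let κ : Type _ := ∀ p : {k // k ∈ A} × {l // l ∉ A}, Fin (m p.1 p.2)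
  have hcard : Fintype.card κ = cutCapacity m A := by
    simp only [κ, Fintype.card_pi, Fintype.card_fin, Fintype.prod_prod_type, cutCapacity,
      Finset.prod_subtype Aᶜ fun _ => Finset.mem_compl]
    exact Finset.prod_coe_sort A fun k => ∏ l : {l // l ∉ A}, m k l
  let w (k l : ι) (i : Fin (m k l)) (j : Fin (m l k)) : ℂ := if (k, l) ∈ E then χ k l i j else 1
  have hE (s : ∀ k l, Fin (m k l)) : ∏ e ∈ E, χ e.1 e.2 (s e.1 e.2) (s e.2 e.1) =
      ∏ k, ∏ l, w k l (s k l) (s l k) := by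
    simp only [w, ← Fintype.prod_prod_type', Finset.prod_ite_mem, Finset.univ_inter]
  have hsplit (f : ι → ℂ) : ∏ k, f k = (∏ k : {k // k ∈ A}, f k) * ∏ k : {k // k ∉ A}, f k := by
    rw [← A.prod_mul_prod_compl f, Finset.prod_subtype Aᶜ fun _ => Finset.mem_compl,
      Finset.prod_coe_sort A f]
  rw [← hcard]
  refine schmidtRank_le_card (fun a p => a p.1 p.2)
    (fun a => ∏ k : {k // k ∈ A}, ∏ l : {l // l ∈ A}, w k l (a k l) (a l k))
    (fun c b => (∏ k : {k // k ∈ A}, ∏ l : {l // l ∉ A}, w k l (c (k, l)) (b l k)) *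
      ((∏ k : {k // k ∉ A}, ∏ l : {l // l ∈ A}, w k l (b k l) (c (l, k))) *
        ∏ k : {k // k ∉ A}, ∏ l : {l // l ∉ A}, w k l (b k l) (b l k))) fun s => ?_
  simp only [hE, hsplit, Finset.prod_mul_distrib]
  ring

theorem card_le_of_conjTranspose_mul_self {a b : Type*} [Fintype a] [Fintype b] [DecidableEq b]
    (V : Matrix a b ℂ) (hV : V.conjTranspose * V = 1) : Fintype.card b ≤ Fintype.card a :=
  calc Fintype.card b = (V.conjTranspose * V).rank := by rw [hV, Matrix.rank_one]
    _ ≤ V.rank := Matrix.rank_mul_le_right _ _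
    _ ≤ Fintype.card a := Matrix.rank_le_card_height _

theorem two_le_of_not_product {m n : ℕ} {χ : Fin m → Fin n → ℂ}
    (hχ : ¬ ∃ (a : Fin m → ℂ) (b : Fin n → ℂ), ∀ i j, χ i j = a i * b j) : 2 ≤ m ∧ 2 ≤ n := by
  constructor <;> by_contra! hlt
  · have := Fin.subsingleton_iff_le_one.2 (Nat.le_of_lt_succ hlt)
    refine hχ ⟨1, fun j => ∑ i, χ i j, fun i j => ?_⟩
    simp [Fintype.sum_subsingleton _ i]
  · have := Fin.subsingleton_iff_le_one.2 (Nat.le_of_lt_succ hlt)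
    refine hχ ⟨fun i => ∑ j, χ i j, 1, fun i j => ?_⟩
    simp [Fintype.sum_subsingleton _ j]

theorem ConsistsOfBipartite.exists_dims {N : ℕ} {d : Fin N → ℕ} {φ : Ket d}
    (h : ConsistsOfBipartite φ) :
    ∃ m : Fin N → Fin N → ℕ, (∀ k l, 1 ≤ m k l) ∧ (∀ k l, 2 ≤ m k l → 2 ≤ m l k) ∧
      (∀ k, ∏ l, m k l ≤ d k) ∧ ∀ A : Finset (Fin N), schmidtRank A φ ≤ cutCapacity m A := by
  obtain ⟨G, _, m, χ, V, hm, hχ, hV, hφ⟩ := h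
  have hadj {k l : Fin N} (h : G.Adj k l) : 2 ≤ m k l := by
    rcases lt_or_gt_of_ne h.ne with hkl | hkl
    · exact (two_le_of_not_product (hχ k l hkl h).2).1
    · exact (two_le_of_not_product (hχ l k hkl h.symm).2).2
  refine ⟨m, fun k l => ?_, fun k l hkl => ?_, fun k => ?_, fun A => ?_⟩
  · by_cases h : G.Adj k l
    · exact one_le_two.trans (hadj h)
    · exact (hm k l h).ge
  · by_contra hlk
    have h : ¬ G.Adj k l := fun h => hlk (hadj h.symm)
    simp [hm k l h] at hkl
  · simpa [Fintype.card_pi] using card_le_of_conjTranspose_mul_self (V k) (hV k)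
  · rw [funext hφ]
    exact (schmidtRank_tensor_le A V _).trans (schmidtRank_prod_edges_le A m χ _)

theorem exists_cutCapacity_insert_le_two {m : ι → ι → ℕ} (hm : ∀ k l, 1 ≤ m k l)
    (hsymm : ∀ k l, 2 ≤ m k l → 2 ≤ m l k) (hd : ∀ k, ∏ l, m k l ≤ 4) {A : Finset ι}
    (hA : cutCapacity m A = 2) : ∃ w ∉ A, cutCapacity m (insert w A) ≤ 2 := by
  obtain ⟨k, hk, w, hw, hkw⟩ : ∃ k ∈ A, ∃ w ∈ Aᶜ, 2 ≤ m k w := by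
    by_contra! h
    have : cutCapacity m A = 1 := Finset.prod_eq_one fun k hk => Finset.prod_eq_one fun l hl =>
      le_antisymm (Nat.le_of_lt_succ (h k hk l hl)) (hm k l)
    omega
  have hcompl : Aᶜ = insert w (insert w A)ᶜ := by
    rw [Finset.compl_insert, Finset.insert_erase hw]
  have hwA : w ∉ A := Finset.mem_compl.1 hw
  refine ⟨w, hwA, ?_⟩
  have hsplit : (∏ k ∈ A, m k w) * ∏ k ∈ A, ∏ l ∈ (insert w A)ᶜ, m k l = 2 := by
    rw [← hA, cutCapacity, hcompl, ← Finset.prod_mul_distrib]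
    exact Finset.prod_congr rfl fun k _ => (Finset.prod_insert (by simp)).symm
  have hAw : 2 ≤ ∏ k ∈ A, m k w :=
    hkw.trans (Finset.single_le_prod' (f := (m · w)) (fun k _ => hm k w) hk)
  have hwk : 2 * ∏ l ∈ (insert w A)ᶜ, m w l ≤ 4 :=
    calc 2 * ∏ l ∈ (insert w A)ᶜ, m w l ≤ m w k * ∏ l ∈ (insert w A)ᶜ, m w l :=
          Nat.mul_le_mul_right _ (hsymm k w hkw)
      _ = ∏ l ∈ insert k (insert w A)ᶜ, m w l := (Finset.prod_insert (by simp [hk])).symm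
      _ ≤ ∏ l, m w l := Finset.prod_le_prod_of_subset_of_one_le' (Finset.subset_univ _)
          fun l _ _ => hm w l
      _ ≤ 4 := hd w
  rw [cutCapacity, Finset.prod_insert hwA]
  nlinarith

end Bipartite

/-! ### Schmidt ranks of the target states -/

section Targets

theorem foldr_zzGate {κ : Type*} {V : Type} (α : κ → ℝ) (u v : κ → V) (L : List κ)
    (ψ : (V → Fin 2) → ℂ) (b : V → Fin 2) :
    L.foldr (fun i ψ => zzGate (α i) (u i) (v i) ψ) ψ b =
      (L.map fun i => Complex.exp (Complex.I * (α i * zSign (b (u i)) * zSign (b (v i))))).prod *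
        ψ b := by
  induction L with
  | nil => simp
  | cons i L ih => simp [zzGate, ih, mul_assoc]

theorem targetKet_apply (α : Fin 7 → ℝ) (b : Fin 8 → Fin 2) :
    targetKet α b = (1 / (√2 : ℂ)) ^ 8 *
      ∏ i, Complex.exp (Complex.I * (α i * zSign (b i.castSucc) * zSign (b (parent i)))) := by
  refine (foldr_zzGate α Fin.castSucc parent (List.finRange 7) (plusKet (Fin 8)) b).trans ?_
  rw [← List.ofFn_eq_map, List.prod_ofFn, mul_comm, plusKet, Fintype.card_fin]

/-- The matrix of the amplitudes of `exp(iπ/4 Z ⊗ Z)`. -/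
def zzMatrix : Matrix (Fin 2) (Fin 2) ℂ :=
  Matrix.of fun p q => Complex.exp (Complex.I * ((Real.pi / 4 : ℝ) * zSign p * zSign q))

theorem zzMatrix_comm (p q : Fin 2) : zzMatrix p q = zzMatrix q p := by
  simp only [zzMatrix, Matrix.of_apply, mul_right_comm]

theorem det_zzMatrix : zzMatrix.det = 2 * Complex.I := by
  have hdiag : Complex.I * ((Real.pi / 4 : ℝ) * (1 : ℝ) * (1 : ℝ)) +
      Complex.I * ((Real.pi / 4 : ℝ) * (-1 : ℝ) * (-1 : ℝ)) = Real.pi / 2 * Complex.I := by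
    push_cast; ring
  have hoff : Complex.I * ((Real.pi / 4 : ℝ) * (1 : ℝ) * (-1 : ℝ)) +
      Complex.I * ((Real.pi / 4 : ℝ) * (-1 : ℝ) * (1 : ℝ)) = -(Real.pi / 2 * Complex.I) := by
    push_cast; ring
  simp only [Matrix.det_fin_two, zzMatrix, Matrix.of_apply, zSign, ← Complex.exp_add, if_true,
    one_ne_zero, if_false, hdiag, hoff, Complex.exp_neg, Complex.exp_pi_div_two_mul_I,
    Complex.inv_I]
  ring

/-- The tensor power of a matrix, with one factor for each element of `κ`. -/
def tensorPower (κ : Type*) [Fintype κ] {n : Type*} (M : Matrix n n ℂ) : Matrix (κ → n) (κ → n) ℂ :=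
  Matrix.of fun p q => ∏ c, M (p c) (q c)

theorem tensorPower_mul {κ n : Type*} [Fintype κ] [DecidableEq κ] [Fintype n]
    (M M' : Matrix n n ℂ) :
    tensorPower κ M * tensorPower κ M' = tensorPower κ (M * M') := by
  ext p q
  simp only [tensorPower, Matrix.mul_apply, Matrix.of_apply, ← Finset.prod_mul_distrib,
    Fintype.prod_sum]

theorem tensorPower_one {κ n : Type*} [Fintype κ] [DecidableEq n] :
    tensorPower κ (1 : Matrix n n ℂ) = 1 := by
  ext p q
  simp [tensorPower, Matrix.one_apply, Fintype.prod_ite_zero, funext_iff]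

theorem det_tensorPower_ne_zero {κ n : Type*} [Fintype κ] [DecidableEq κ] [Fintype n]
    [DecidableEq n] {M : Matrix n n ℂ} (hM : M.det ≠ 0) : (tensorPower κ M).det ≠ 0 := by
  refine Matrix.det_ne_zero_of_left_inverse (B := tensorPower κ M⁻¹) ?_
  rw [tensorPower_mul, Matrix.nonsing_inv_mul _ hM.isUnit, tensorPower_one]

/-- The angles with the value `π/4` at the gates in `I` and `0` at the others. -/
def quarterAngles (I : Finset (Fin 7)) (i : Fin 7) : ℝ := if i ∈ I then Real.pi / 4 else 0

theorem targetKet_quarterAngles_mem (I : Finset (Fin 7)) : targetKet (quarterAngles I) ∈ S₀ := by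
  refine ⟨_, fun i => ?_, rfl⟩
  have := Real.pi_pos
  unfold quarterAngles
  split_ifs <;> constructor <;> linarith

theorem targetKet_quarterAngles (I : Finset (Fin 7)) :
    targetKet (quarterAngles I) = (1 / (√2 : ℂ)) ^ 8 • fun b =>
      ∏ i : I, zzMatrix (b (i : Fin 7).castSucc) (b (parent i)) := by
  refine funext fun (b : Fin 8 → Fin 2) => (targetKet_apply _ b).trans (congrArg _ ?_)
  refine Eq.trans ?_ (Finset.prod_coe_sort I fun i => zzMatrix (b i.castSucc) (b (parent i))).symm
  rw [← Finset.prod_subset (Finset.subset_univ I) fun i _ hi => by simp [quarterAngles, hi]]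
  exact Finset.prod_congr rfl fun i hi => by simp [quarterAngles, hi, zzMatrix]

/-- The two parties on which the `i`-th gate acts. -/
def gateSupport (i : Fin 7) : Finset (Fin 8) := {i.castSucc, parent i}

theorem exists_eq_on_gateSupport {I : Finset (Fin 7)}
    (hI : (I : Set (Fin 7)).PairwiseDisjoint gateSupport) (p : I → Fin 2) :
    ∃ b : Fin 8 → Fin 2, ∀ i : I, ∀ k ∈ gateSupport i, b k = p i := by
  refine ⟨fun k => ∑ i : I, if k ∈ gateSupport i then p i else 0, fun i k hk => ?_⟩
  beta_reduce
  rw [Fintype.sum_eq_single i fun j hj => if_neg fun hkj => ?_, if_pos hk]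
  exact Finset.disjoint_left.1 (hI j.2 i.2 fun h => hj (Subtype.ext h)) hkj hk

theorem two_pow_card_le_schmidtRank_targetKet {A : Set (Fin 8)} {I : Finset (Fin 7)}
    (hA : ∀ i ∈ I, ¬ (i.castSucc ∈ A ↔ parent i ∈ A))
    (hI : (I : Set (Fin 7)).PairwiseDisjoint gateSupport) :
    2 ^ I.card ≤ schmidtRank A (targetKet (quarterAngles I)) := by
  classical
  choose a ha using exists_eq_on_gateSupport hI
  have hentry (p q : I → Fin 2) (i : I) :
      zzMatrix (A.piecewise (a p) (a q) (i : Fin 7).castSucc)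
        (A.piecewise (a p) (a q) (parent i)) = zzMatrix (p i) (q i) := by
    have hcast (p : I → Fin 2) : a p (i : Fin 7).castSucc = p i := ha p i _ (by simp [gateSupport])
    have hparent (p : I → Fin 2) : a p (parent i) = p i := ha p i _ (by simp [gateSupport])
    by_cases h : (i : Fin 7).castSucc ∈ A
    · have h' : parent i ∉ A := fun h' => hA i i.2 (iff_of_true h h')
      simp [h, h', hcast, hparent]
    · have h' : parent i ∈ A := by_contra fun h' => hA i i.2 (iff_of_false h h')
      simp [h, h', hcast, hparent, zzMatrix_comm (q i)]
  rw [targetKet_quarterAngles, schmidtRank_smul A (by simp)]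
  refine le_trans (by simp) (card_le_schmidtRank a a (κ := I → Fin 2) ?_)
  convert det_tensorPower_ne_zero (κ := I) (det_zzMatrix.trans_ne (by simp))
  ext p q
  exact Finset.prod_congr rfl fun i _ => hentry p q i

theorem AchievesStatic.two_pow_card_le_schmidtRank {φ : Ket d₀} (h : AchievesStatic φ S₀)
    (hφ : φ ≠ 0) {A : Set (Fin 8)} {I : Finset (Fin 7)}
    (hA : ∀ i ∈ I, ¬ (i.castSucc ∈ A ↔ parent i ∈ A))
    (hI : (I : Set (Fin 7)).PairwiseDisjoint gateSupport) : 2 ^ I.card ≤ schmidtRank A φ := by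
  obtain ⟨P, hP, hT⟩ := h _ (targetKet_quarterAngles_mem I)
  calc 2 ^ I.card ≤ schmidtRank A (targetKet (quarterAngles I)) :=
        two_pow_card_le_schmidtRank_targetKet hA hI
    _ ≤ schmidtRank A (embed d₀ (targetKet (quarterAngles I))) :=
        schmidtRank_le_schmidtRank_embed (by decide) A _
    _ ≤ schmidtRank A φ := schmidtRank_le_of_transforms A hP hφ hT

theorem exists_gate_across {A : Set (Fin 8)} (hA : A.Nonempty) (hA' : Aᶜ.Nonempty) :
    ∃ i : Fin 7, ¬ (i.castSucc ∈ A ↔ parent i ∈ A) := by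
  by_contra! h
  have hroot (k : Fin 8) : k ∈ A ↔ 7 ∈ A := by
    have h0 := h 0; have h1 := h 1; have h2 := h 2; have h3 := h 3
    have h4 := h 4; have h5 := h 5; have h6 := h 6
    fin_cases k <;> simp_all [parent]
  obtain ⟨k, hk⟩ := hA
  obtain ⟨l, hl⟩ := hA'
  exact hl ((hroot l).2 ((hroot k).1 hk))

theorem AchievesStatic.fullyEntangled {φ : Ket d₀} (h : AchievesStatic φ S₀) (hφ : φ ≠ 0) :
    FullyEntangled φ := by
  intro A hA hA' hprod
  obtain ⟨i, hi⟩ := exists_gate_across hA hA'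
  have htwo : 2 ^ ({i} : Finset (Fin 7)).card ≤ schmidtRank A φ :=
    h.two_pow_card_le_schmidtRank hφ (by simpa using hi) (by simp)
  have hone := hprod.schmidtRank_le_one
  rw [Finset.card_singleton] at htwo
  omega

theorem IsState.ne_zero {N : ℕ} {d : Fin N → ℕ} {φ : Ket d} (hφ : IsState φ) : φ ≠ 0 := by
  rintro rfl
  simp [IsState] at hφ

end Targets

/-! ### Bipartite entanglement does not suffice -/

section NoGo

/-- Two gates on disjoint pairs of parties act across the bipartition of the parties into `A` and
its complement. -/
abbrev HasDisjointGatesAcross (A : Finset (Fin 8)) : Prop :=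
  ∃ i j : Fin 7, i ≠ j ∧ Disjoint (gateSupport i) (gateSupport j) ∧
    ¬ (i.castSucc ∈ A ↔ parent i ∈ A) ∧ ¬ (j.castSucc ∈ A ↔ parent j ∈ A)

theorem hasDisjointGatesAcross_pair :
    ∀ u : Fin 8, u ≠ 7 → u ≠ 6 → HasDisjointGatesAcross {u, 7} := by
  decide

theorem hasDisjointGatesAcross_triple :
    ∀ w : Fin 8, w ≠ 7 → w ≠ 6 → HasDisjointGatesAcross {w, 6, 7} := by
  decide

theorem AchievesStatic.four_le_schmidtRank {φ : Ket d₀} (h : AchievesStatic φ S₀) (hφ : φ ≠ 0)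
    {A : Finset (Fin 8)} (hA : HasDisjointGatesAcross A) : 4 ≤ schmidtRank A φ := by
  obtain ⟨i, j, hij, hdisj, hi, hj⟩ := hA
  rw [show 4 = 2 ^ ({i, j} : Finset (Fin 7)).card by simp [Finset.card_pair hij]]
  refine h.two_pow_card_le_schmidtRank hφ (by simp_all) ?_
  rw [Finset.coe_pair, Set.PairwiseDisjoint, Set.pairwise_pair_of_symm]
  exact fun _ => hdisj

theorem d₀_le_four : ∀ k, d₀ k ≤ 4 := by
  decide

theorem not_achievesStatic_of_consistsOfBipartite {φ : Ket d₀} (hφ : φ ≠ 0)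
    (hb : ConsistsOfBipartite φ) : ¬ AchievesStatic φ S₀ := by
  intro h
  obtain ⟨m, hm, hsymm, hd, hrank⟩ := hb.exists_dims
  have hd4 (k : Fin 8) : ∏ l, m k l ≤ 4 := (hd k).trans (d₀_le_four k)
  have htwo {A : Finset (Fin 8)} (h7 : 7 ∈ A) (hA : Aᶜ.Nonempty) : 2 ≤ cutCapacity m A := by
    obtain ⟨i, hi⟩ := exists_gate_across (A := A) ⟨7, h7⟩ (by exact_mod_cast hA)
    exact (h.two_pow_card_le_schmidtRank (I := {i}) hφ (by simpa using hi) (by simp)).trans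
      (hrank A)
  have hgrow {A : Finset (Fin 8)} (h7 : 7 ∈ A) (hA : Aᶜ.Nonempty) (hcap : cutCapacity m A ≤ 2) :
      ∃ w ∉ A, cutCapacity m (insert w A) ≤ 2 :=
    exists_cutCapacity_insert_le_two hm hsymm hd4 (hcap.antisymm (htwo h7 hA))
  have hcap7 : cutCapacity m {7} ≤ 2 := by
    rw [cutCapacity, Finset.prod_singleton]
    exact (Finset.prod_le_prod_of_subset_of_one_le' (Finset.subset_univ _)
      fun l _ _ => hm 7 l).trans (hd 7)
  obtain ⟨u, hu, hcapu⟩ := hgrow (A := {7}) (by simp) (by decide) hcap7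
  obtain rfl : u = 6 := by
    by_contra hu6
    have := h.four_le_schmidtRank hφ (hasDisjointGatesAcross_pair u (by simpa using hu) hu6)
    have := hrank {u, 7}
    omega
  obtain ⟨w, hw, hcapw⟩ := hgrow (A := {6, 7}) (by simp) (by decide) hcapu
  rw [Finset.mem_insert, Finset.mem_singleton, not_or] at hw
  have := h.four_le_schmidtRank hφ (hasDisjointGatesAcross_triple w hw.2 hw.1)
  have := hrank {w, 6, 7}
  omega

end NoGo

/-! ### The fifteen qubits -/

section Qubits

open scoped Kronecker

/-- The qubits of the resource state, labelled as in `qubitValues`. -/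
abbrev Qubit : Type := Fin 8 ⊕ Fin 7

/-- The party that holds a qubit. -/
def Qubit.party : Qubit → Fin 8
  | .inl k => k
  | .inr i => i.castSucc

/-- The position of a qubit in the system of its party. -/
def Qubit.slot : Qubit → Slot
  | .inl _ => .target
  | .inr _ => .auxiliary

/-- The dimension of the rest of the system of the party that holds a qubit. -/
def Qubit.restDim : Qubit → ℕ
  | .inl k => d₀ k / 2
  | .inr _ => 2

/-- The factorization of the system of a party into one of its qubits and the rest. -/
def Qubit.split : (q : Qubit) → Fin (d₀ q.party) ≃ Fin 2 × Fin q.restDim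
  | .inl k => (finCongr ((by decide : ∀ k, d₀ k = d₀ k / 2 * 2) k)).trans
      (finProdFinEquiv.symm.trans (Equiv.prodComm _ _))
  | .inr i => (finCongr ((by decide : ∀ i : Fin 7, d₀ i.castSucc = 2 * 2) i)).trans
      finProdFinEquiv.symm

theorem Qubit.val_split_fst (q : Qubit) (y : Fin (d₀ q.party)) :
    (q.split y).1.val = q.slot.bit y := by
  cases q <;> rfl

theorem Qubit.val_split_snd (q : Qubit) (y : Fin (d₀ q.party)) :
    (q.split y).2.val = q.slot.other.bit y := by
  cases q <;> rfl

theorem Qubit.split_fst (q : Qubit) (x : Config d₀) :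
    (q.split (x q.party)).1 = qubitValues x q := by
  refine Fin.ext ((q.val_split_fst _).trans ?_)
  cases q with
  | inl k => rfl
  | inr i =>
    have h : (x i.castSucc).val < 4 := (x i.castSucc).2.trans_le (d₀_le_four _)
    exact (Nat.mod_eq_of_lt (Nat.div_lt_of_lt_mul h)).symm

theorem Qubit.slot_eq_other_of_party_eq {q r : Qubit} (hqr : q ≠ r) (h : q.party = r.party) :
    q.slot = r.slot.other := by
  rcases q with k | i <;> rcases r with l | j
  · exact absurd (congrArg Sum.inl h) hqr
  · rfl
  · rfl
  · exact absurd (congrArg Sum.inr (Fin.castSucc_injective _ h)) hqr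

theorem qubitValues_eq_of_bit_eq {q : Qubit} {x y : Config d₀}
    (h : q.slot.bit (x q.party) = q.slot.bit (y q.party)) : qubitValues x q = qubitValues y q := by
  rw [← q.split_fst, ← q.split_fst]
  exact Fin.ext (by rw [q.val_split_fst, q.val_split_fst, h])

/-- The basis label that arises from `x` by giving the qubit `q` the value `o`. -/
def setQubit (x : Config d₀) (q : Qubit) (o : Fin 2) : Config d₀ :=
  Function.update x q.party (q.split.symm (o, (q.split (x q.party)).2))

theorem qubitValues_setQubit (x : Config d₀) (q : Qubit) (o : Fin 2) :
    qubitValues (setQubit x q o) = Function.update (qubitValues x) q o := by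
  refine Function.eq_update_iff.2 ⟨?_, fun (r : Qubit) hr => ?_⟩
  · rw [← q.split_fst, setQubit, Function.update_self, Equiv.apply_symm_apply]
  · refine qubitValues_eq_of_bit_eq ?_
    by_cases h : r.party = q.party
    · rw [Qubit.slot_eq_other_of_party_eq hr h, h, ← q.val_split_snd, ← q.val_split_snd, setQubit,
        Function.update_self, Equiv.apply_symm_apply]
    · rw [setQubit, Function.update_of_ne h]

/-- A function of the fifteen qubits as a vector of the total system. -/
def lift (ψ : (Qubit → Fin 2) → ℂ) : Ket d₀ := fun x => ψ (qubitValues x)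

/-- The operator `K` on the qubit `q`, as an operator on the system of its party. -/
def qubitOp (q : Qubit) (K : Matrix (Fin 2) (Fin 2) ℂ) :
    Matrix (Fin (d₀ q.party)) (Fin (d₀ q.party)) ℂ :=
  (K ⊗ₖ (1 : Matrix (Fin q.restDim) (Fin q.restDim) ℂ)).submatrix q.split q.split

theorem sum_conjTranspose_mul_qubitOp (q : Qubit) {n : ℕ} {K : Fin n → Matrix (Fin 2) (Fin 2) ℂ}
    (hK : ∑ j, (K j).conjTranspose * K j = 1) :
    ∑ j, (qubitOp q (K j)).conjTranspose * qubitOp q (K j) = 1 := by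
  have hmul (j : Fin n) : (qubitOp q (K j)).conjTranspose * qubitOp q (K j) =
      qubitOp q ((K j).conjTranspose * K j) := by
    simp [qubitOp, Matrix.conjTranspose_kronecker, ← Matrix.mul_kronecker_mul]
  have hsum : ∑ j, qubitOp q ((K j).conjTranspose * K j) =
      qubitOp q (∑ j, (K j).conjTranspose * K j) := by
    ext y y'
    simp [qubitOp, Matrix.sum_apply, Finset.sum_mul]
  rw [Finset.sum_congr rfl fun j _ => hmul j, hsum, hK]
  simp [qubitOp]

theorem applyLocal_qubitOp (q : Qubit) (K : Matrix (Fin 2) (Fin 2) ℂ)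
    (ψ : (Qubit → Fin 2) → ℂ) :
    applyLocal q.party (qubitOp q K) (lift ψ) =
      lift fun b => ∑ o, K (b q) o * ψ (Function.update b q o) := by
  ext x
  rw [applyLocal, ← q.split.symm.sum_comp, Fintype.sum_prod_type]
  refine Finset.sum_congr rfl fun o _ => ?_
  rw [Fintype.sum_eq_single (q.split (x q.party)).2 fun r hr => ?_]
  · rw [← qubitValues_setQubit, ← q.split_fst]
    simp [qubitOp, lift, setQubit]
  · simp [qubitOp, Matrix.one_apply_ne hr.symm]

/-- The communication of the qubit `q` into the qubit `r`. -/
def sendQubit (q r : Qubit) (h : q.party ≠ r.party) : Communication d₀ where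
  sender := q.party
  receiver := r.party
  ne := h
  dim := 2
  restS := q.restDim
  restR := r.restDim
  splitS := q.split
  splitR := r.split

theorem isSingleQubit_sendQubit (q r : Qubit) (h : q.party ≠ r.party) :
    (sendQubit q r h).IsSingleQubit :=
  ⟨rfl, ⟨q.slot, fun y => ⟨q.val_split_fst y, q.val_split_snd y⟩⟩,
    ⟨r.slot, fun y => ⟨r.val_split_fst y, r.val_split_snd y⟩⟩⟩

theorem exchange_sendQubit {q r : Qubit} (h : q.party ≠ r.party) (x : Config d₀) :
    (sendQubit q r h).exchange x =
      setQubit (setQubit x q (qubitValues x r)) r (qubitValues x q) := by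
  simp only [setQubit, Function.update_of_ne h.symm, ← Qubit.split_fst]
  rfl

theorem transmit_sendQubit_lift {q r : Qubit} (h : q.party ≠ r.party)
    (ψ : (Qubit → Fin 2) → ℂ) :
    (sendQubit q r h).transmit (lift ψ) = lift fun b => ψ (b ∘ Equiv.swap q r) := by
  ext x
  rw [Communication.transmit, exchange_sendQubit, lift, lift, qubitValues_setQubit,
    qubitValues_setQubit, Equiv.swap_comm, Equiv.comp_swap_eq_update]

end Qubits

/-! ### Preparation of the resource state -/

section Preparation

/-- The sign `±1` of the amplitudes of the graph state with the edges `E`. -/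
def graphSign {V : Type*} (E : Multiset (V × V)) (b : V → Fin 2) : ℂ :=
  (E.map fun e => if b e.1 = 1 ∧ b e.2 = 1 then -1 else 1).prod

theorem graphSign_cons {V : Type*} (e : V × V) (E : Multiset (V × V)) (b : V → Fin 2) :
    graphSign (e ::ₘ E) b = (if b e.1 = 1 ∧ b e.2 = 1 then -1 else 1) * graphSign E b := by
  rw [graphSign, Multiset.map_cons, Multiset.prod_cons, graphSign]

theorem norm_graphSign {V : Type*} (E : Multiset (V × V)) (b : V → Fin 2) :
    ‖graphSign E b‖ = 1 := by
  induction E using Multiset.induction_on with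
  | empty => simp [graphSign]
  | cons e E ih => rw [graphSign_cons, norm_mul, ih]; split_ifs <;> simp

theorem graphSign_update {V : Type*} [DecidableEq V] {E : Multiset (V × V)} {q : V}
    (hq : ∀ e ∈ E, e.1 ≠ q ∧ e.2 ≠ q) (b : V → Fin 2) (o : Fin 2) :
    graphSign E (Function.update b q o) = graphSign E b :=
  congrArg Multiset.prod <| Multiset.map_congr rfl fun e he => by
    rw [Function.update_of_ne (hq e he).1, Function.update_of_ne (hq e he).2]

theorem graphSign_comp {V W : Type*} (f : V → W) (E : Multiset (V × V)) (b : W → Fin 2) :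
    graphSign E (b ∘ f) = graphSign (E.map (Prod.map f f)) b := by
  simp [graphSign]

theorem graphKet_apply {V : Type} [Fintype V] (E : List (V × V)) (b : V → Fin 2) :
    graphKet E b = (1 / (√2 : ℂ)) ^ Fintype.card V * graphSign E b := by
  induction E with
  | nil => simp [graphKet, graphSign, plusKet]
  | cons e E ih =>
    rw [← Multiset.cons_coe, graphSign_cons, mul_left_comm, ← ih, graphKet, List.foldr_cons, cz]
    split_ifs
    · rw [neg_one_mul, graphKet]
    · rw [one_mul, graphKet]

theorem Φres_eq_smul_lift :
    Φres = (1 / (√2 : ℂ)) ^ Fintype.card Qubit • lift (graphSign resEdges) :=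
  funext fun x => graphKet_apply resEdges (qubitValues x)

theorem isState_Φres : IsState Φres := by
  have hnorm (x : Config d₀) : ‖Φres x‖ ^ 2 = (1 / 2 : ℝ) ^ 15 := by
    rw [Φres_eq_smul_lift, Pi.smul_apply, norm_smul, lift, norm_graphSign, mul_one, norm_pow,
      norm_div, norm_one, Complex.norm_real, Real.norm_of_nonneg (Real.sqrt_nonneg 2), ← pow_mul,
      mul_comm, pow_mul, div_pow, Real.sq_sqrt two_pos.le, one_pow]
    rfl
  have hcard : Fintype.card (Config d₀) = 2 ^ 15 := by
    rw [Fintype.card_pi]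
    simp only [Fintype.card_fin]
    decide
  rw [IsState, Finset.sum_congr rfl fun x _ => hnorm x, Finset.sum_const, Finset.card_univ, hcard]
  norm_num

/-- A stage of the preparation: the qubits initialized so far, and the edges of their graph state.
The other qubits are in the state `|0⟩`. -/
abbrev Stage : Type := Finset Qubit × Multiset (Qubit × Qubit)

/-- The vector of a stage of the preparation, up to normalization. -/
def Stage.ket (G : Stage) (b : Qubit → Fin 2) : ℂ :=
  if ∀ q ∉ G.1, b q = 0 then graphSign G.2 b else 0

/-- The elementary steps of the preparation: initialization of a qubit as `|+⟩`, the `CZ` gate on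
the two qubits of `v_i`, and communication of a qubit. -/
inductive PrepStep
  | plus (q : Qubit)
  | link (i : Fin 7)
  | move (q r : Qubit) (h : q.party ≠ r.party)

/-- The stage reached by an elementary step, which is `none` if the step is not possible. -/
def PrepStep.next : PrepStep → Stage → Option Stage
  | .plus q, (I, E) =>
      if q ∉ I ∧ ∀ e ∈ E, e.1 ≠ q ∧ e.2 ≠ q then some (insert q I, E) else none
  | .link i, (I, E) => some (I, (Sum.inr i, Sum.inl i.castSucc) ::ₘ E)
  | .move q r _, (I, E) =>
      if r ∉ I then
        some (I.map (Equiv.swap q r).toEmbedding,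
          E.map (Prod.map (Equiv.swap q r) (Equiv.swap q r)))
      else none

/-- The protocol that starts with an elementary step and goes on with `P`. -/
def PrepStep.prepend : PrepStep → Protocol d₀ → Protocol d₀
  | .plus q, P => .measure q.party 2 (initPlus q.party q.slot) fun _ => P
  | .link i, P => .measure i.castSucc 1 (fun _ => localCZ i.castSucc) fun _ => P
  | .move q r h, P => .send (sendQubit q r h) P

theorem initPlus_eq_qubitOp (q : Qubit) (j : Fin 2) :
    initPlus q.party q.slot j =
      qubitOp q (Matrix.of fun _ o => if o = j then 1 / (√2 : ℂ) else 0) := by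
  ext y x
  simp only [initPlus, qubitOp, Matrix.of_apply, Matrix.submatrix_apply, Matrix.kroneckerMap_apply,
    Matrix.one_apply, Fin.ext_iff, q.val_split_fst, q.val_split_snd, mul_ite, mul_one, mul_zero,
    ite_and]
  split_ifs <;> rfl

theorem sum_conjTranspose_mul_initPlus (q : Qubit) :
    ∑ j, (initPlus q.party q.slot j).conjTranspose * initPlus q.party q.slot j = 1 := by
  simp only [initPlus_eq_qubitOp]
  refine sum_conjTranspose_mul_qubitOp q ?_
  have hsqrt : (√2 : ℂ) * √2 = 2 := by
    rw [← Complex.ofReal_mul, Real.mul_self_sqrt two_pos.le, Complex.ofReal_ofNat]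
  ext a b
  fin_cases a <;> fin_cases b <;>
    simp [Matrix.mul_apply, ← mul_inv, hsqrt]

theorem conjTranspose_mul_localCZ (k : Fin 8) :
    (localCZ k).conjTranspose * localCZ k = 1 := by
  rw [localCZ, Matrix.diagonal_conjTranspose, Matrix.diagonal_mul_diagonal, ← Matrix.diagonal_one]
  congr 1
  ext x
  dsimp only [Pi.star_apply]
  split_ifs <;> simp

theorem applyLocal_localCZ_lift (i : Fin 7) (ψ : (Qubit → Fin 2) → ℂ) :
    applyLocal i.castSucc (localCZ i.castSucc) (lift ψ) =
      lift fun b => (if b (.inr i) = 1 ∧ b (.inl i.castSucc) = 1 then -1 else 1) * ψ b := by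
  ext x
  have ha := congrArg Fin.val (Qubit.split_fst (.inr i) x)
  have ht := congrArg Fin.val (Qubit.split_fst (.inl i.castSucc) x)
  rw [Qubit.val_split_fst] at ha ht
  simp only [localCZ, applyLocal_diagonal, lift, Fin.ext_iff, ← ha, ← ht]
  exact congrArg (· * ψ (qubitValues x)) (if_congr and_comm rfl rfl)

theorem PrepStep.isValid_prepend (s : PrepStep) {P : Protocol d₀} (hP : P.IsValid) :
    (s.prepend P).IsValid := by
  cases s with
  | plus q => exact ⟨sum_conjTranspose_mul_initPlus q, fun _ => hP⟩
  | link i =>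
    exact ⟨(Fin.sum_univ_one _).trans (conjTranspose_mul_localCZ i.castSucc), fun _ => hP⟩
  | move q r h => exact hP

theorem PrepStep.isCZSequence_prepend (s : PrepStep) {P : Protocol d₀} (hP : IsCZSequence P) :
    IsCZSequence (s.prepend P) := by
  cases s with
  | plus q => exact .initPlus q.party q.slot P hP
  | link i => exact .localCZ i.castSucc P hP
  | move q r h => exact .send (sendQubit q r h) P (isSingleQubit_sendQubit q r h) hP

theorem Stage.ket_update {I : Finset Qubit} {E : Multiset (Qubit × Qubit)} {q : Qubit}
    (hq : q ∉ I) (hE : ∀ e ∈ E, e.1 ≠ q ∧ e.2 ≠ q) (b : Qubit → Fin 2) (j : Fin 2) :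
    Stage.ket (I, E) (Function.update b q j) =
      (if j = 0 then 1 else 0) * Stage.ket (insert q I, E) b := by
  have hiff : (∀ r ∉ I, Function.update b q j r = 0) ↔ j = 0 ∧ ∀ r ∉ insert q I, b r = 0 := by
    refine ⟨fun h => ⟨by simpa using h q hq, fun r hr => ?_⟩, fun h r hr => ?_⟩
    · rw [Finset.mem_insert, not_or] at hr
      simpa [hr.1] using h r hr.2
    · by_cases hrq : r = q
      · subst hrq; simpa using h.1
      · rw [Function.update_of_ne hrq]
        exact h.2 r (by simp [hrq, hr])
  simp only [ket, hiff, graphSign_update hE, ite_and, ite_mul, one_mul, zero_mul]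

theorem Stage.ket_comp_swap (I : Finset Qubit) (E : Multiset (Qubit × Qubit)) (q r : Qubit)
    (b : Qubit → Fin 2) :
    Stage.ket (I, E) (b ∘ Equiv.swap q r) =
      Stage.ket (I.map (Equiv.swap q r).toEmbedding,
        E.map (Prod.map (Equiv.swap q r) (Equiv.swap q r))) b := by
  have hiff : (∀ s ∉ I, (b ∘ Equiv.swap q r) s = 0) ↔
      ∀ s ∉ I.map (Equiv.swap q r).toEmbedding, b s = 0 := by
    rw [(Equiv.swap q r).forall_congr_left]
    simp [Finset.mem_map_equiv]
  simp only [ket, hiff, graphSign_comp]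

theorem PrepStep.transforms_prepend {s : PrepStep} {G G' : Stage} (hG : s.next G = some G')
    {P : Protocol d₀} {ψ : Ket d₀} (hP : P.Transforms (lift G'.ket) ψ) :
    (s.prepend P).Transforms (lift G.ket) ψ := by
  obtain ⟨I, E⟩ := G
  cases s with
  | plus q =>
    obtain ⟨⟨hq, hE⟩, hG⟩ := Option.ite_none_right_eq_some.1 hG
    obtain rfl := Option.some.inj hG
    intro j
    have hj : applyLocal q.party (initPlus q.party q.slot j) (lift (Stage.ket (I, E))) =
        (1 / (√2 : ℂ) * if j = 0 then 1 else 0) • lift (Stage.ket (insert q I, E)) := by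
      rw [initPlus_eq_qubitOp, applyLocal_qubitOp]
      ext x
      simp only [lift, Matrix.of_apply, ite_mul, zero_mul, Finset.sum_ite_eq', Finset.mem_univ,
        if_true, Stage.ket_update hq hE, Pi.smul_apply, smul_eq_mul, mul_assoc]
    rw [hj]
    exact hP.smul_left _
  | link i =>
    obtain rfl := Option.some.inj hG
    intro _
    rw [applyLocal_localCZ_lift]
    convert hP using 2
    ext b
    simp only [Stage.ket, graphSign_cons, mul_ite, mul_zero]
  | move q r h =>
    obtain ⟨hr, hG⟩ := Option.ite_none_right_eq_some.1 hG
    obtain rfl := Option.some.inj hG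
    refine ⟨fun x hx => if_neg fun h0 => hx ?_, ?_⟩
    · exact congrArg Fin.val ((r.split_fst x).trans (h0 r hr))
    · rw [transmit_sendQubit_lift h]
      simpa only [Stage.ket_comp_swap] using hP

/-- The protocol that performs the listed elementary steps. -/
def prepProtocol (steps : List PrepStep) : Protocol d₀ :=
  steps.foldr PrepStep.prepend .halt

theorem isValid_prepProtocol (steps : List PrepStep) : (prepProtocol steps).IsValid := by
  induction steps with
  | nil => trivial
  | cons s steps ih => exact s.isValid_prepend ih

theorem isCZSequence_prepProtocol (steps : List PrepStep) :
    IsCZSequence (prepProtocol steps) := by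
  induction steps with
  | nil => exact .halt
  | cons s steps ih => exact s.isCZSequence_prepend ih

theorem prepProtocol_transforms {steps : List PrepStep} {G G' : Stage}
    (h : steps.foldlM (fun G s => s.next G) G = some G') :
    (prepProtocol steps).Transforms (lift G.ket) (lift G'.ket) := by
  induction steps generalizing G with
  | nil => exact ⟨1, by rw [one_smul, Option.some.inj h]⟩
  | cons s steps ih =>
    obtain ⟨G₁, hs, hsteps⟩ := Option.bind_eq_some_iff.1 h
    exact PrepStep.transforms_prepend hs (ih hsteps)

theorem forall_qubitValues_eq_zero_iff (x : Config d₀) :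
    (∀ q, qubitValues x q = 0) ↔ ∀ k, (x k).val = 0 := by
  constructor
  · intro h k
    have htarget := congrArg Fin.val (h (.inl k))
    cases k using Fin.lastCases with
    | last => exact (Nat.mod_eq_of_lt (x (Fin.last 7)).2).symm.trans htarget
    | cast i =>
      have haux := congrArg Fin.val (h (.inr i))
      have hlt : (x i.castSucc).val < 4 := (x i.castSucc).2.trans_le (d₀_le_four _)
      simp only [qubitValues, Fin.ofNat_eq_cast, Fin.val_natCast, Fin.val_zero] at htarget haux
      omega
  · rintro h (k | i) <;> simp [qubitValues, h]

theorem zeroKet_eq_lift : zeroKet d₀ = lift (Stage.ket (∅, 0)) := by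
  ext x
  simp [zeroKet, lift, Stage.ket, graphSign, ← forall_qubitValues_eq_zero_iff]

/-- A preparation of the resource state: each target qubit is created at one of the parties whose
auxiliary qubits it is to be linked to, visits the others, and ends at its own party. -/
def resourceSteps : List PrepStep :=
  (List.finRange 7).map (fun i => .plus (.inr i)) ++
  [.plus (.inl 3), .link 3, .move (.inl 3) (.inl 5) (by decide), .link 5,
    .move (.inl 5) (.inl 6) (by decide), .link 6, .move (.inl 6) (.inl 7) (by decide),
    .plus (.inl 1), .link 1, .move (.inl 1) (.inl 2) (by decide), .link 2,
    .move (.inl 2) (.inl 3) (by decide), .link 3,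
    .plus (.inl 4), .link 4, .move (.inl 4) (.inl 5) (by decide), .link 5,
    .plus (.inl 0), .link 0, .move (.inl 0) (.inl 1) (by decide), .link 1,
    .plus (.inl 0), .link 0, .plus (.inl 2), .link 2, .plus (.inl 4), .link 4,
    .plus (.inl 6), .link 6]

theorem foldlM_resourceSteps :
    resourceSteps.foldlM (fun G s => s.next G) ((∅, 0) : Stage) =
      some (Finset.univ, (resEdges : Multiset (Qubit × Qubit))) := by
  decide +kernel

theorem prepProtocol_resourceSteps_transforms :
    (prepProtocol resourceSteps).Transforms (zeroKet d₀) Φres := by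
  have h := prepProtocol_transforms foldlM_resourceSteps
  have hket : Stage.ket (Finset.univ, (resEdges : Multiset (Qubit × Qubit))) = graphSign resEdges :=
    funext fun b => if_pos fun q hq => absurd (Finset.mem_univ q) hq
  rw [hket, ← zeroKet_eq_lift] at h
  rw [Φres_eq_smul_lift]
  exact h.smul_right (by simp)

end Preparation

/-! ### Gates by local measurements -/

section Gates

/-- The sign of the two edges at an auxiliary qubit with value `a`, for the values `t` and `t'` of
its neighbours. -/
def linkSign (a t t' : Fin 2) : ℂ := ((zSign t : ℂ) * zSign t') ^ a.val

/-- The factor of the gate `exp(iθ Z ⊗ Z)`, with the auxiliary qubit in the state `|0⟩`. -/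
def gateFactor (θ : ℝ) (a t t' : Fin 2) : ℂ :=
  if a = 0 then Complex.exp (Complex.I * (θ * zSign t * zSign t')) else 0

/-- A product with one factor for each gate `i`, depending on the auxiliary qubit of `v_i` and on
the two target qubits on which the gate acts. -/
def gateProduct (F : Fin 7 → Fin 2 → Fin 2 → Fin 2 → ℂ) (b : Qubit → Fin 2) : ℂ :=
  ∏ i, F i (b (.inr i)) (b (.inl i.castSucc)) (b (.inl (parent i)))

theorem gateProduct_update (F : Fin 7 → Fin 2 → Fin 2 → Fin 2 → ℂ) (i : Fin 7)
    (f : Fin 2 → Fin 2 → Fin 2 → ℂ) (b : Qubit → Fin 2) (a : Fin 2) :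
    gateProduct (Function.update F i f) (Function.update b (.inr i) a) =
      f a (b (.inl i.castSucc)) (b (.inl (parent i))) *
        ∏ j ∈ Finset.univ.erase i,
          F j (b (.inr j)) (b (.inl j.castSucc)) (b (.inl (parent j))) := by
  rw [gateProduct, ← Finset.mul_prod_erase _ _ (Finset.mem_univ i)]
  refine congrArg₂ (· * ·) (by simp) (Finset.prod_congr rfl fun j hj => ?_)
  simp [Finset.ne_of_mem_erase hj]

theorem graphSign_flatMap_links (L : List (Fin 7)) (b : Qubit → Fin 2) :
    graphSign (L.flatMap fun i =>
        [((Sum.inr i, Sum.inl i.castSucc) : Qubit × Qubit), (Sum.inr i, Sum.inl (parent i))] :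
        List (Qubit × Qubit)) b =
      (L.map fun i => linkSign (b (.inr i)) (b (.inl i.castSucc)) (b (.inl (parent i)))).prod := by
  have hlink (a t t' : Fin 2) : ((if a = 1 ∧ t = 1 then (-1 : ℂ) else 1) *
      if a = 1 ∧ t' = 1 then -1 else 1) = linkSign a t t' := by
    fin_cases a <;> fin_cases t <;> fin_cases t' <;> simp [linkSign, zSign]
  induction L with
  | nil => simp [graphSign]
  | cons i L ih =>
    rw [List.flatMap_cons, List.cons_append, List.cons_append, List.nil_append,
      ← Multiset.cons_coe, ← Multiset.cons_coe, graphSign_cons, graphSign_cons, ih, ← mul_assoc,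
      hlink, List.map_cons, List.prod_cons]

theorem graphSign_resEdges : graphSign resEdges = gateProduct fun _ => linkSign :=
  funext fun b => by
    rw [resEdges, graphSign_flatMap_links, ← List.ofFn_eq_map, List.prod_ofFn, gateProduct]

theorem embed_targetKet (α : Fin 7 → ℝ) :
    embed d₀ (targetKet α) =
      (1 / (√2 : ℂ)) ^ 8 • lift (gateProduct fun i => gateFactor (α i)) := by
  ext x
  have haux (i : Fin 7) : (x i.castSucc).val < 2 ↔ qubitValues x (.inr i) = 0 := by
    have hval : (x i.castSucc).val / 2 = (qubitValues x (.inr i)).val :=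
      (Qubit.val_split_fst (.inr i) (x i.castSucc)).symm.trans
        (congrArg Fin.val (Qubit.split_fst (.inr i) x))
    rw [Fin.ext_iff, ← hval, Fin.val_zero]
    omega
  rw [Pi.smul_apply, smul_eq_mul, lift, gateProduct, embed]
  split_ifs with h
  · have htarget (k : Fin 8) : (⟨(x k).val, h k⟩ : Fin 2) = qubitValues x (.inl k) :=
      Fin.ext (Nat.mod_eq_of_lt (h k)).symm
    refine (targetKet_apply α fun k => ⟨(x k).val, h k⟩).trans ?_
    refine congrArg _ (Finset.prod_congr rfl fun i _ => ?_)
    rw [gateFactor, if_pos ((haux i).1 (h _)), ← htarget, ← htarget]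
  · obtain ⟨i, hi⟩ : ∃ i : Fin 7, qubitValues x (.inr i) ≠ 0 := by
      by_contra! hall
      exact h (Fin.lastCases (x (Fin.last 7)).2 fun i => (haux i).2 (hall i))
    rw [Finset.prod_eq_zero (Finset.mem_univ i) (if_neg hi), mul_zero]

/-- The amplitudes of the bras `cos θ ⟨o| + i sin θ ⟨1 - o|`. -/
def gateBra (θ : ℝ) (o a : Fin 2) : ℂ :=
  if a = o then Complex.cos θ else Complex.I * Complex.sin θ

/-- The Kraus operators of the measurement of an auxiliary qubit in the basis `gateBra θ`, with
the qubit reset to `|0⟩`. -/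
def gateKraus (θ : ℝ) (o : Fin 2) : Matrix (Fin 2) (Fin 2) ℂ :=
  Matrix.of fun a' a => if a' = 0 then gateBra θ o a else 0

/-- The correction `Z ^ o`. -/
def zPower (o : Fin 2) : Matrix (Fin 2) (Fin 2) ℂ :=
  Matrix.diagonal fun t => (zSign t : ℂ) ^ o.val

theorem sum_conjTranspose_mul_gateKraus (θ : ℝ) :
    ∑ o, (gateKraus θ o).conjTranspose * gateKraus θ o = 1 := by
  have hstar (o a : Fin 2) :
      star (gateBra θ o a) = if a = o then Complex.cos θ else -(Complex.I * Complex.sin θ) := by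
    rw [gateBra]
    split_ifs <;> simp [← Complex.cos_conj, ← Complex.sin_conj]
  have hnorm : Complex.cos θ * Complex.cos θ +
      -(Complex.I * Complex.sin θ) * (Complex.I * Complex.sin θ) = 1 := by
    linear_combination Complex.cos_sq_add_sin_sq (θ : ℂ) - Complex.sin θ ^ 2 * Complex.I_sq
  have hbra (a a' : Fin 2) :
      ∑ o, star (gateBra θ o a) * gateBra θ o a' = if a = a' then 1 else 0 := by
    simp only [hstar]
    simp only [gateBra, Fin.sum_univ_two]
    fin_cases a <;> fin_cases a' <;>
      simp only [Fin.zero_eta, Fin.mk_one, one_ne_zero, zero_ne_one, if_true, if_false]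
    · exact hnorm
    · ring
    · ring
    · exact (add_comm _ _).trans hnorm
  ext a a'
  simp [Matrix.sum_apply, Matrix.mul_apply, Matrix.one_apply, gateKraus, ← hbra a a']

theorem conjTranspose_mul_zPower (o : Fin 2) : (zPower o).conjTranspose * zPower o = 1 := by
  ext a a'
  fin_cases o <;> fin_cases a <;> fin_cases a' <;> simp [zPower, zSign, Matrix.mul_apply]

theorem applyLocal_zPower (q : Qubit) (o : Fin 2) (ψ : (Qubit → Fin 2) → ℂ) :
    applyLocal q.party (qubitOp q (zPower o)) (lift ψ) =
      lift fun b => (zSign (b q) : ℂ) ^ o.val * ψ b := by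
  rw [applyLocal_qubitOp]
  simp [zPower, Matrix.diagonal_apply]

-- With `s = zSign t * zSign t'`, so that `s ^ 2 = 1`, Euler's formula reads
-- `exp(iθs) = cos θ + s i sin θ = s ^ o * ∑ a, gateBra θ o a * s ^ a`.
theorem sum_gateBra_mul_linkSign (θ : ℝ) (o t t' : Fin 2) :
    (zSign t' : ℂ) ^ o.val * ((zSign t : ℂ) ^ o.val * ∑ a, gateBra θ o a * linkSign a t t') =
      Complex.exp (Complex.I * (θ * zSign t * zSign t')) := by
  have hpos : Complex.exp (Complex.I * θ) = Complex.cos θ + Complex.I * Complex.sin θ := by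
    rw [mul_comm, Complex.exp_mul_I, mul_comm Complex.I]
  have hneg : Complex.exp (-(Complex.I * θ)) = Complex.cos θ - Complex.I * Complex.sin θ := by
    rw [mul_comm, ← neg_mul, Complex.exp_mul_I, Complex.cos_neg, Complex.sin_neg]
    ring
  fin_cases o <;> fin_cases t <;> fin_cases t' <;>
    simp [gateBra, linkSign, zSign, hpos, hneg] <;> ring

/-- The protocol that applies the gates in the list `L`: for each gate the auxiliary qubit is
measured, and the outcome is corrected on the two target qubits. -/
def gateProtocol (α : Fin 7 → ℝ) : List (Fin 7) → Protocol d₀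
  | [] => .halt
  | i :: L =>
    .measure (Qubit.party (.inr i)) 2 (fun o => qubitOp (.inr i) (gateKraus (α i) o)) fun o =>
    .measure (Qubit.party (.inl i.castSucc)) 1 (fun _ => qubitOp (.inl i.castSucc) (zPower o))
      fun _ =>
    .measure (Qubit.party (.inl (parent i))) 1 (fun _ => qubitOp (.inl (parent i)) (zPower o))
      fun _ => gateProtocol α L

theorem isLOCC_gateProtocol (α : Fin 7 → ℝ) (L : List (Fin 7)) : (gateProtocol α L).IsLOCC := by
  induction L with
  | nil => exact ⟨trivial, trivial⟩
  | cons i L ih =>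
    have hz (q : Qubit) (o : Fin 2) :
        ∑ _j : Fin 1, (qubitOp q (zPower o)).conjTranspose * qubitOp q (zPower o) = 1 :=
      sum_conjTranspose_mul_qubitOp q ((Fin.sum_univ_one _).trans (conjTranspose_mul_zPower o))
    exact ⟨⟨sum_conjTranspose_mul_qubitOp _ (sum_conjTranspose_mul_gateKraus (α i)), fun o =>
      ⟨hz _ o, fun _ => ⟨hz _ o, fun _ => ih.1⟩⟩⟩, fun _ _ _ => ih.2⟩

theorem applyLocal_gate {F : Fin 7 → Fin 2 → Fin 2 → Fin 2 → ℂ} {i : Fin 7} (hF : F i = linkSign)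
    (θ : ℝ) (o : Fin 2) :
    applyLocal (Qubit.party (.inl (parent i))) (qubitOp (.inl (parent i)) (zPower o))
      (applyLocal (Qubit.party (.inl i.castSucc)) (qubitOp (.inl i.castSucc) (zPower o))
        (applyLocal (Qubit.party (.inr i)) (qubitOp (.inr i) (gateKraus θ o))
          (lift (gateProduct F)))) =
      lift (gateProduct (Function.update F i (gateFactor θ))) := by
  rw [applyLocal_qubitOp, applyLocal_zPower, applyLocal_zPower]
  refine congrArg lift (funext fun b => ?_)
  have hbefore (a : Fin 2) := gateProduct_update F i (F i) b a
  have hafter := gateProduct_update F i (gateFactor θ) b (b (.inr i))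
  rw [Function.update_eq_self] at hafter
  simp only [Function.update_eq_self] at hbefore
  rw [hafter, gateFactor]
  simp only [hbefore, hF, gateKraus, Matrix.of_apply]
  split_ifs
  · rw [← sum_gateBra_mul_linkSign θ o]
    simp only [mul_assoc, Finset.sum_mul]
  · simp

/-- The factors of the state in which the gates in the list `L` are still to be applied. -/
def pendingFactor (α : Fin 7 → ℝ) (L : List (Fin 7)) (i : Fin 7) : Fin 2 → Fin 2 → Fin 2 → ℂ :=
  if i ∈ L then linkSign else gateFactor (α i)

theorem pendingFactor_eq_update {α : Fin 7 → ℝ} {i : Fin 7} {L : List (Fin 7)} (hi : i ∉ L) :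
    Function.update (pendingFactor α (i :: L)) i (gateFactor (α i)) = pendingFactor α L := by
  refine (Function.eq_update_iff.2 ⟨if_neg hi, fun j hj => ?_⟩).symm
  simp [pendingFactor, hj]

theorem gateProtocol_transforms (α : Fin 7 → ℝ) {L : List (Fin 7)} (hL : L.Nodup) :
    (gateProtocol α L).Transforms (lift (gateProduct (pendingFactor α L)))
      (embed d₀ (targetKet α)) := by
  induction L with
  | nil =>
    rw [embed_targetKet]
    have h : Protocol.halt.Transforms (lift (gateProduct (pendingFactor α [])))
        (lift (gateProduct (pendingFactor α []))) := ⟨1, (one_smul ℂ _).symm⟩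
    exact h.smul_right (by simp)
  | cons i L ih =>
    intro o _ _
    obtain ⟨hi, hL⟩ := List.nodup_cons.1 hL
    rw [applyLocal_gate (if_pos List.mem_cons_self), pendingFactor_eq_update hi]
    exact ih hL

theorem achievesStatic_Φres : AchievesStatic Φres S₀ := by
  rintro _ ⟨α, -, rfl⟩
  refine ⟨gateProtocol α (List.finRange 7), isLOCC_gateProtocol α _, ?_⟩
  have hpending : pendingFactor α (List.finRange 7) = fun _ => linkSign :=
    funext fun i => if_pos (List.mem_finRange i)
  rw [Φres_eq_smul_lift, graphSign_resEdges, ← hpending]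
  exact (gateProtocol_transforms α (List.nodup_finRange 7)).smul_left _

end Gates

end SizeLimited

end

theorem proposition3 :
    SizeLimited.IsState SizeLimited.Φres ∧
    SizeLimited.FullyEntangled SizeLimited.Φres ∧
    (∃ P : SizeLimited.Protocol SizeLimited.d₀, P.IsValid ∧ SizeLimited.IsCZSequence P ∧
      P.Transforms (SizeLimited.zeroKet SizeLimited.d₀) SizeLimited.Φres) ∧
    SizeLimited.AchievesDynamic SizeLimited.Φres SizeLimited.S₀ ∧
    ∀ φ : SizeLimited.Ket SizeLimited.d₀,
      SizeLimited.IsState φ → SizeLimited.ConsistsOfBipartite φ →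
        ¬ SizeLimited.AchievesStatic φ SizeLimited.S₀ := by
  have hvalid := SizeLimited.isValid_prepProtocol SizeLimited.resourceSteps
  have hprep := SizeLimited.prepProtocol_resourceSteps_transforms
  exact ⟨SizeLimited.isState_Φres,
    SizeLimited.achievesStatic_Φres.fullyEntangled SizeLimited.isState_Φres.ne_zero,
    ⟨_, hvalid, SizeLimited.isCZSequence_prepProtocol _, hprep⟩,
    ⟨⟨_, hvalid, hprep⟩, SizeLimited.achievesStatic_Φres⟩,
    fun _ hφ hb => SizeLimited.not_achievesStatic_of_consistsOfBipartite hφ.ne_zero hb⟩
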